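/- **Definitions.** Let $(E;\oplus,0,1)$ be an effect algebra, i.e. $\oplus$ is a partial operation on $E$ which is commutative and associative (whenever $a\oplus b$ and $(a\oplus b)\oplus c$ are defined, so are $b\oplus c$ and $a\oplus(b\oplus c)$, and the two triple sums agree), every $a$ has a unique orthosupplement $a'$ with $a\oplus a'=1$, and if $a\oplus 1$ is defined then $a=0$. Write $a\le b$ if $a\oplus c=b$ for some $c$, and then $b\ominus a:=c$. $E$ is *archimedean* if $a=0$ whenever $na=a\oplus\dots\oplus a$ ($n$ summands) exists for all $n\in\mathbb N$. Elements $a,b$ are *Mackey compatible* ($a\leftrightarrow b$) if $a=a_1\oplus c$ and $b=b_1\oplus c$ for some $a_1,b_1,c$ such that $a_1\oplus b_1\oplus c$ exists. A *compression* is an additive map $J:E\to E$ such that $a\le J(1)$ implies $J(a)=a$, and $J(a)=0\iff a\le J(1)'$. A *compression base* is a family $(J_p)_{p\in P}$ of compressions indexed by a sub-effect algebra $P\subseteq E$ (its elements are called *projections*) with $J_p(1)=p$ for all $p\in P$, and such that $p\leftrightarrow q$ implies $J_p\circ J_q=J_r$ for some $r\in P$. Fix a compression base. For $p\in P$ put $C(p)=\{a: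 a=J_p(a)\oplus J_{p'}(a)\}$, and for $A\subseteq E$ put $PC(A)=\{p\in P: A\subseteq C(p)\}$ and $P(A)=PC(PC(A)\cup A)$; write $P(a)=P(\{a\})$ and $P(a,b)=P(\{a,b\})$. Elements $a,b$ *commute* if $p\leftrightarrow q$ for all $p\in P(a)$, $q\in P(b)$. Put $$P_\le(a,b)=\{p\in P(a,b): J_p(a)\le J_p(b),\ J_{p'}(b)\le J_{p'}(a)\}.$$ $E$ has *b-comparability* if (a) for every $a\in E$ there is a Boolean subalgebra $B\subseteq P$ such that for all $p\in P$: $a\in C(p)\iff B\subseteq C(p)$; and (b) $P_\le(a,b)\ne\emptyset$ for all commuting $a,b$. $E$ has the *projection cover property* if for every $a\in E$ there is a (unique) $a^{\rm o}\in P$ such that for all $q\in P$: $a\le q\iff a^{\rm o}\le q$. $E$ (with the given compression base) is *spectral* if it has both properties. Let $E$ be spectral. For commuting $a,b$ put $(b-a)_+=J_p(b)\ominus J_p(a)$, where $p\in P_\le(a,b)$ (the choice of $p$ does not matter). For $a\in E$ and binary strings $w$ define $c_w,u_w\in E$ recursively: $c_\varepsilon=a$ and $u_\varepsilon=a^{\rm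 o}$ for the empty string $\varepsilon$, and $$u_{w0}=((c_w-c_w')_+^{\rm o})'\wedge u_w,\quad u_{w1}=u_w\wedge u_{w0}',\quad c_{w0}=u_{w0}\ominus\big((c_w'-c_w)_+\wedge u_w\big),\quad c_{w1}=(c_w-c_w')_+\wedge u_w .$$ For $w=w_1\dots w_l$ let $\lambda(w)=\sum_{j=1}^{l}w_j2^{-j}$; every dyadic rational in $(0,1)$ is $\lambda(w1)$ for a unique $w$. The *binary spectral resolution* of $a$ is the family $p_{a,\lambda}$, indexed by the dyadic rationals $\lambda\in[0,1]$, given by $p_{a,0}=(a^{\rm o})'$, $p_{a,1}=1$ and $$p_{a,\lambda(w1)}=(a^{\rm o})'\oplus\bigoplus_{v} u_{v},$$ where the sum is over the binary strings $v$ of length $l(w)+1$ with $v\le w0$ in the lexicographical order. **Proposition.** Let $E$ be an effect algebra that is spectral with respect to a given compression base. Then the following are equivalent: 1. for every $a\in E$ and every dyadic rational $\lambda\in[0,1]$, the element $p_{a,\lambda}$ is the infimum in $E$ of $\{p_{a,\mu}:\ \mu\in[0,1]\text{ a dyadic rational},\ \mu>\lambda\}$ (the infimum of the empty set being $1$); 2.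 $E$ is archimedean. -/

import Mathlib

universe u

/-- An effect algebra `(E; ⊕, 0, 1)`. The partial operation `⊕` is encoded by an `Option`-valued
operation: `oplus a b = some c` means that `a ⊕ b` is defined and equal to `c`, and
`oplus a b = none` means that `a ⊕ b` is undefined. -/
class EffectAlgebra (E : Type u) extends Zero E, One E where
  /-- the partial sum -/
  oplus : E → E → Option E
  oplus_comm : ∀ a b c : E, oplus a b = some c → oplus b a = some c
  oplus_assoc : ∀ a b c d e : E, oplus a b = some d → oplus d c = some e →
    ∃ f, oplus b c = some f ∧ oplus a f = some e
  existsUnique_orthosupplement : ∀ a : E, ∃! b : E, oplus a b = some 1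
  eq_zero_of_oplus_one : ∀ a c : E, oplus a 1 = some c → a = 0

namespace EffectAlgebra

variable {E : Type u} [EffectAlgebra E]

/-- The orthosupplement `a'`, written `aᶜ`: the unique element with `a ⊕ a' = 1`. -/
noncomputable instance instComplOrthosupplement : Compl E where
  compl a := (existsUnique_orthosupplement a).choose

theorem oplus_compl (a : E) : oplus a aᶜ = some 1 :=
  (existsUnique_orthosupplement a).choose_spec.1

theorem eq_compl {a b : E} (h : oplus a b = some 1) : b = aᶜ :=
  (existsUnique_orthosupplement a).choose_spec.2 b h

theorem compl_one : (1 : E)ᶜ = 0 :=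
  eq_zero_of_oplus_one _ _ (oplus_comm _ _ _ (oplus_compl (1 : E)))

theorem one_oplus_zero : oplus (1 : E) 0 = some 1 := by
  have h := oplus_compl (1 : E)
  rwa [compl_one] at h

theorem compl_compl' (a : E) : aᶜᶜ = a :=
  (eq_compl (oplus_comm _ _ _ (oplus_compl a))).symm

/-- `a ⊕ 0 = a`. -/
theorem oplus_zero (a : E) : oplus a 0 = some a := by
  obtain ⟨f, hf, hf'⟩ := oplus_assoc aᶜ a 0 1 1
    (oplus_comm _ _ _ (oplus_compl a)) one_oplus_zero
  rw [hf, eq_compl hf', compl_compl']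

/-- Cancellation: `a ⊕ b = a ⊕ c` implies `b = c`. -/
theorem oplus_cancel {a b c d : E} (hb : oplus a b = some d) (hc : oplus a c = some d) :
    b = c := by
  have key : ∀ x : E, oplus a x = some d →
      ∃ g, oplus dᶜ a = some g ∧ oplus g x = some 1 := by
    intro x hx
    obtain ⟨f, hf, hf'⟩ := oplus_assoc x a dᶜ d 1 (oplus_comm _ _ _ hx) (oplus_compl d)
    exact ⟨f, oplus_comm _ _ _ hf, oplus_comm _ _ _ hf'⟩
  obtain ⟨g, hg, hgb⟩ := key b hb
  obtain ⟨g', hg', hgc⟩ := key c hc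
  rw [hg] at hg'
  obtain rfl := Option.some.inj hg'
  rw [eq_compl hgb, eq_compl hgc]

/-- `a ⊕ b = 0` implies `a = 0`. -/
theorem eq_zero_of_oplus_eq_zero {a b : E} (h : oplus a b = some 0) : a = 0 := by
  obtain ⟨f, hf, _⟩ := oplus_assoc b a 1 0 1 (oplus_comm _ _ _ h)
    (oplus_comm _ _ _ one_oplus_zero)
  exact eq_zero_of_oplus_one _ _ hf

/-- The order of an effect algebra: `a ≤ b` iff `a ⊕ c = b` for some `c`. -/
instance instPartialOrder : PartialOrder E where
  le a b := ∃ c, oplus a c = some b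
  le_refl a := ⟨0, oplus_zero a⟩
  le_trans := by
    rintro a b c ⟨x, hx⟩ ⟨y, hy⟩
    obtain ⟨f, _, hf⟩ := oplus_assoc a x y b c hx hy
    exact ⟨f, hf⟩
  le_antisymm := by
    rintro a b ⟨x, hx⟩ ⟨y, hy⟩
    obtain ⟨f, hf, hf'⟩ := oplus_assoc a x y b a hx hy
    have h0 : f = 0 := oplus_cancel hf' (oplus_zero a)
    subst h0
    rw [eq_zero_of_oplus_eq_zero hf, oplus_zero] at hx
    exact Option.some.inj hx

open Classical in
/-- The difference `b ⊖ a`: the unique `c` with `a ⊕ c = b`, defined if `a ≤ b`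
(default value `0` otherwise). -/
noncomputable def ominus (b a : E) : E :=
  if h : ∃ c, oplus a c = some b then h.choose else 0

open Classical in
/-- The infimum `a ∧ b` in `E`, if it exists (default value `0` otherwise). -/
noncomputable def meet (a b : E) : E :=
  if h : ∃ c, IsGLB {a, b} c then h.choose else 0

/-- The finite sum `a₁ ⊕ ⋯ ⊕ aₙ`, if it is defined (the empty sum is `0`). -/
def osum (l : List E) : Option E :=
  l.foldlM (fun x y => oplus x y) 0

/-- Mackey compatibility `a ↔ b`: there are `a₁, b₁, c` such that `a₁ ⊕ b₁ ⊕ c` is defined,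
`a = a₁ ⊕ c` and `b = b₁ ⊕ c`. -/
def MackeyCompatible (a b : E) : Prop :=
  ∃ a₁ b₁ c d e : E, oplus a₁ b₁ = some d ∧ oplus d c = some e ∧
    oplus a₁ c = some a ∧ oplus b₁ c = some b

/-- A sub-effect algebra of `E`. -/
structure IsSubEffectAlgebra (F : Set E) : Prop where
  zero_mem : (0 : E) ∈ F
  one_mem : (1 : E) ∈ F
  compl_mem : ∀ a ∈ F, aᶜ ∈ F
  oplus_mem : ∀ a ∈ F, ∀ b ∈ F, ∀ c, oplus a b = some c → c ∈ F

/-- A Boolean subalgebra: a sub-effect algebra which, with the order and the orthosupplementation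
of `E`, is a Boolean algebra. -/
structure IsBooleanSubalgebra (B : Set E) : Prop where
  isSubEffectAlgebra : IsSubEffectAlgebra B
  isBoolean : ∃ (A : Type u) (_ : BooleanAlgebra A) (φ : A ≃o B),
    ∀ x : A, ((φ xᶜ : B) : E) = ((φ x : B) : E)ᶜ

/-- Additive maps `E → E`. -/
def IsAdditive (J : E → E) : Prop :=
  ∀ a b c : E, oplus a b = some c → oplus (J a) (J b) = some (J c)

/-- Retractions on `E`; the focus of `J` is `J 1`. -/
structure IsRetraction (J : E → E) : Prop where
  additive : IsAdditive J
  apply_eq : ∀ a : E, a ≤ J 1 → J a = a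

/-- Compressions on `E`. -/
structure IsCompression (J : E → E) : Prop where
  isRetraction : IsRetraction J
  apply_eq_zero_iff : ∀ a : E, J a = 0 ↔ a ≤ (J 1)ᶜ

variable (E) in
/-- `E` is archimedean: if `na = a ⊕ ⋯ ⊕ a` (`n` times) exists for all `n`, then `a = 0`. -/
def IsArchimedean : Prop :=
  ∀ a : E, (∀ n : ℕ, ∃ c, osum (List.replicate n a) = some c) → a = 0

end EffectAlgebra

open EffectAlgebra in
/-- A compression base `(J p)_{p ∈ P}` on `E`. Only the values `J p` with `p ∈ P` matter. -/
structure CompressionBase (E : Type u) [EffectAlgebra E] where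
  /-- the set of projections -/
  P : Set E
  /-- the compressions -/
  J : E → E → E
  isSubEffectAlgebra : IsSubEffectAlgebra P
  isCompression : ∀ p ∈ P, IsCompression (J p)
  focus : ∀ p ∈ P, J p 1 = p
  comp : ∀ p ∈ P, ∀ q ∈ P, MackeyCompatible p q → ∃ r ∈ P, J p ∘ J q = J r

namespace CompressionBase

open EffectAlgebra

variable {E : Type u} [EffectAlgebra E] (K : CompressionBase E)

/-- The commutant `C(p) = {a | a = J_p(a) ⊕ J_{p'}(a)}` of a projection `p`. -/
def commutant (p : E) : Set E := {a | oplus (K.J p a) (K.J pᶜ a) = some a}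

/-- `PC(A)`: the projections `p` with `A ⊆ C(p)`. -/
def PC (A : Set E) : Set E := {p | p ∈ K.P ∧ A ⊆ K.commutant p}

/-- `P(A) = PC(PC(A) ∪ A)`; for `A = {a}` this is the bicommutant of `a`. -/
def bicommutant (A : Set E) : Set E := K.PC (K.PC A ∪ A)

/-- `a` is a b-element: there is a Boolean subalgebra `B ⊆ P` such that, for `p ∈ P`,
`a ∈ C(p)` iff `B ⊆ C(p)`. -/
def IsBElement (a : E) : Prop :=
  ∃ B : Set E, B ⊆ K.P ∧ IsBooleanSubalgebra B ∧
    ∀ p ∈ K.P, a ∈ K.commutant p ↔ B ⊆ K.commutant p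

/-- `e` and `f` commute, `e C f`: all elements of `P(e)` and `P(f)` are Mackey compatible. -/
def Commutes (e f : E) : Prop :=
  ∀ p ∈ K.bicommutant {e}, ∀ q ∈ K.bicommutant {f}, MackeyCompatible p q

/-- The set `P_≤(e,f)` of all `p ∈ P(e,f)` with `J_p(e) ≤ J_p(f)` and `J_{p'}(f) ≤ J_{p'}(e)`. -/
def Ple (e f : E) : Set E :=
  {p | p ∈ K.bicommutant {e, f} ∧ K.J p e ≤ K.J p f ∧ K.J pᶜ f ≤ K.J pᶜ e}

/-- The b-comparability property. -/
structure BComparability : Prop where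
  isBElement : ∀ a : E, K.IsBElement a
  ple_nonempty : ∀ e f : E, K.Commutes e f → (K.Ple e f).Nonempty

/-- `p` is a projection cover of `a`. -/
def IsProjectionCover (a p : E) : Prop :=
  p ∈ K.P ∧ ∀ q ∈ K.P, a ≤ q ↔ p ≤ q

/-- `E` is spectral with respect to the compression base `K`: b-comparability and the projection
cover property. -/
structure IsSpectral : Prop where
  bComparability : K.BComparability
  exists_cover : ∀ a : E, ∃ p, K.IsProjectionCover a p

open Classical in
/-- The projection cover `a°` (default value `0` if there is none). -/
noncomputable def cover (a : E) : E :=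
  if h : ∃ p, K.IsProjectionCover a p then h.choose else 0

open Classical in
/-- The element `(b - a)₊ = J_p(b) ⊖ J_p(a)` for `p ∈ P_≤(a,b)`; under b-comparability it is
defined for commuting `a, b` and does not depend on the choice of `p`. -/
noncomputable def posPart (b a : E) : E :=
  if h : (K.Ple a b).Nonempty then ominus (K.J h.choose b) (K.J h.choose a) else 0

/-- One splitting step: from the pair `(c_w, u_w)` and a digit `i` to `(c_{wi}, u_{wi})`, where
* `u_{w0} = (((c_w - c_w')₊)°)' ∧ u_w` and `c_{w0} = u_{w0} ⊖ ((c_w' - c_w)₊ ∧ u_w)`,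
* `u_{w1} = u_w ∧ u_{w0}'` and `c_{w1} = (c_w - c_w')₊ ∧ u_w`. -/
noncomputable def splitStep (x : E × E) (i : Bool) : E × E :=
  let c := x.1
  let u := x.2
  let u0 := meet (K.cover (K.posPart c cᶜ))ᶜ u
  if i then (meet (K.posPart c cᶜ) u, meet u u0ᶜ)
  else (ominus u0 (meet (K.posPart cᶜ c) u), u0)

/-- The pair `(c_w, u_w)` attached to `a` and a binary string `w = w₁ … wₙ`: it is `(a, a°)` for
the empty string, and one splitting step is made for each digit, from the first to the last. -/
noncomputable def cu (a : E) (w : List Bool) : E × E :=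
  w.foldl K.splitStep (a, K.cover a)

/-- The projection `u_w` attached to `a` and a binary string `w`. -/
noncomputable def uProj (a : E) (w : List Bool) : E := (K.cu a w).2

end CompressionBase

/-- The binary string of length `n` that represents the number `k < 2 ^ n` (most significant digit
first). Thus `binWord n 0, binWord n 1, …, binWord n (2 ^ n - 1)` are the binary strings of length
`n` in lexicographical order. -/
def binWord : ℕ → ℕ → List Bool
  | 0, _ => []
  | n + 1, k => binWord n (k / 2) ++ [decide (k % 2 = 1)]

/-- The dyadic rationals in `[0,1]`. -/
def dyadicUnit : Set ℚ := {q | 0 ≤ q ∧ q ≤ 1 ∧ ∃ k n : ℕ, q = (k : ℚ) / 2 ^ n}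

namespace CompressionBase

open EffectAlgebra

variable {E : Type u} [EffectAlgebra E] (K : CompressionBase E)

/-- The binary spectral resolution `p_{a,t}` of `a`, for dyadic rationals `t ∈ [0,1]`:
`p_{a,0} = (a°)'`, `p_{a,1} = 1`, and for `0 < t < 1`
`p_{a,t} = (a°)' ⊕ ⨁ u_v`, the sum over the strings `v` of length `n + 1` with `v ≤ w0`, where
`t = 0.w1` in binary with `w` of length `n`. In lowest terms `t = (2 k + 1) / 2 ^ (n + 1)` with
`w = binWord n k` and `w0 = binWord (n + 1) (2 k)`, so that the strings `v` are
`binWord (n + 1) j` with `j < 2 k + 1 = t.num`, and `n + 1 = Nat.log 2 t.den`.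
(All sums that occur are defined if `E` is spectral; the default value is `0`.) -/
noncomputable def binaryResolution (a : E) (t : ℚ) : E :=
  if t = 0 then (K.cover a)ᶜ
  else if t = 1 then 1
  else (osum ((K.cover a)ᶜ ::
    (List.range t.num.toNat).map fun j => K.uProj a (binWord (Nat.log 2 t.den) j))).getD 0

end CompressionBase

/-! The heart is one splitting step. If `u` is the projection cover of `c`, then `u = u₀ ⊕ u₁`,
where `u₁` is the cover of `(c - c')₊`; the new elements `c₀`, `c₁` again have covers `u₀`, `u₁`,
and `c₀ = 2 J_{u₀}(c)` (`isSplitting_splitStep`). Iterating over zeros, `c_{w0…0}` with `j` zeros is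
`2 ^ j` times the restriction of `c_w` to `u_{w0…0}` (`osum_replicate_J_cu`). Since each `u_w`
splits as `u_{w0} ⊕ u_{w1}`, the value of the resolution at `m / 2 ^ n` is `levelProj a n m`, in
lowest terms or not (`binaryResolution_eq`). With `w` the `m`-th word of length `n`, the value at
`(m + 2 ^ (-j)) / 2 ^ n` is therefore `p ⊕ u_{w0…0}`, where `p` is the value at `m / 2 ^ n`.

Archimedean implies infima: the values are projections, so a lower bound may be replaced by its
cover `q`. If `q ≤ p ⊕ u_{w0…0}` for all `j`, then all multiples `2 ^ j J_q(c_w)` exist, so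
`J_q(c_w) = 0`. Hence `u_w ≤ q'`, and `q ≤ p ⊕ u_w` forces `q ≤ p` (`le_levelProj_of_forall_le`).

Conversely, if all `na` exist, then doubling never meets an obstruction and `u_{0…0} = a°`
(`uProj_replicate_false`). The resolution is then `1` at every positive dyadic, and right continuity
at `0` gives `(a°)' = 1`, so `a = 0`. -/

namespace EffectAlgebra

variable {E : Type u} [EffectAlgebra E]

/-! ### Arithmetic of effect algebras, multiples and additive maps. -/

theorem zero_oplus (a : E) : oplus 0 a = some a := oplus_comm _ _ _ (oplus_zero a)

theorem oplus_assoc_symm {a b c e f : E} (h₁ : oplus b c = some f) (h₂ : oplus a f = some e) :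
    ∃ d, oplus a b = some d ∧ oplus d c = some e := by
  obtain ⟨d, hd, hd'⟩ := oplus_assoc c b a f e (oplus_comm _ _ _ h₁) (oplus_comm _ _ _ h₂)
  exact ⟨d, oplus_comm _ _ _ hd, oplus_comm _ _ _ hd'⟩

theorem oplus_oplus_oplus_comm {a b c d x y z : E} (h₁ : oplus a b = some x)
    (h₂ : oplus c d = some y) (h : oplus x y = some z) :
    ∃ p q, oplus a c = some p ∧ oplus b d = some q ∧ oplus p q = some z := by
  obtain ⟨f, hf, hf'⟩ := oplus_assoc a b y x z h₁ h
  obtain ⟨g, hg, hg'⟩ := oplus_assoc_symm h₂ hf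
  obtain ⟨q, hq, hq'⟩ := oplus_assoc c b d g f (oplus_comm _ _ _ hg) hg'
  obtain ⟨p, hp, hp'⟩ := oplus_assoc_symm hq' hf'
  exact ⟨p, q, hp, hq, hp'⟩

theorem le_of_oplus_left {a b c : E} (h : oplus a b = some c) : a ≤ c := ⟨b, h⟩

theorem le_of_oplus_right {a b c : E} (h : oplus a b = some c) : b ≤ c :=
  ⟨a, oplus_comm _ _ _ h⟩

theorem zero_le' (a : E) : 0 ≤ a := ⟨a, zero_oplus a⟩

theorem le_one' (a : E) : a ≤ 1 := ⟨aᶜ, oplus_compl a⟩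

theorem le_zero_iff' {a : E} : a ≤ 0 ↔ a = 0 :=
  ⟨fun h => le_antisymm h (zero_le' a), fun h => h.le⟩

theorem compl_oplus (a : E) : oplus aᶜ a = some 1 := oplus_comm _ _ _ (oplus_compl a)

theorem le_compl_iff {a b : E} : a ≤ bᶜ ↔ ∃ c, oplus a b = some c := by
  constructor
  · rintro ⟨x, hx⟩
    obtain ⟨f, hf, hf'⟩ := oplus_assoc x a b _ _ (oplus_comm _ _ _ hx) (compl_oplus b)
    exact ⟨f, hf⟩
  · rintro ⟨c, hc⟩
    obtain ⟨f, hf, hf'⟩ := oplus_assoc b a cᶜ c 1 (oplus_comm _ _ _ hc) (oplus_compl c)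
    rw [← eq_compl hf']
    exact ⟨_, hf⟩

theorem le_compl_comm' {a b : E} : a ≤ bᶜ ↔ b ≤ aᶜ := by
  rw [le_compl_iff, le_compl_iff]
  exact ⟨fun ⟨c, h⟩ => ⟨c, oplus_comm _ _ _ h⟩, fun ⟨c, h⟩ => ⟨c, oplus_comm _ _ _ h⟩⟩

theorem oplus_mono {a a' b b' c' : E} (ha : a ≤ a') (hb : b ≤ b') (h : oplus a' b' = some c') :
    ∃ c, oplus a b = some c ∧ c ≤ c' := by
  obtain ⟨x, hx⟩ := ha
  obtain ⟨y, hy⟩ := hb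
  obtain ⟨p, q, hp, _, hpq⟩ := oplus_oplus_oplus_comm hx hy h
  exact ⟨p, hp, le_of_oplus_left hpq⟩

theorem oplus_le_oplus {a a' b b' c c' : E} (ha : a ≤ a') (hb : b ≤ b')
    (h : oplus a b = some c) (h' : oplus a' b' = some c') : c ≤ c' := by
  obtain ⟨d, hd, hle⟩ := oplus_mono ha hb h'
  rw [h] at hd
  cases hd
  exact hle

theorem oplus_cancel_right {a b c d : E} (hb : oplus b a = some d) (hc : oplus c a = some d) :
    b = c :=
  oplus_cancel (oplus_comm _ _ _ hb) (oplus_comm _ _ _ hc)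

theorem ominus_eq {a b c : E} (h : oplus a c = some b) : ominus b a = c := by
  have hex : ∃ c, oplus a c = some b := ⟨c, h⟩
  rw [ominus, dif_pos hex]
  exact oplus_cancel hex.choose_spec h

theorem oplus_ominus {a b : E} (h : a ≤ b) : oplus a (ominus b a) = some b := by
  obtain ⟨c, hc⟩ := h
  rwa [ominus_eq hc]

theorem meet_eq {a b c : E} (h : IsGLB {a, b} c) : meet a b = c := by
  have hex : ∃ c, IsGLB {a, b} c := ⟨c, h⟩
  rw [meet, dif_pos hex]
  exact hex.choose_spec.unique h

theorem isGLB_pair_of_le {a b : E} (h : a ≤ b) : IsGLB {a, b} a := by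
  refine ⟨?_, fun x hx => hx (by simp)⟩
  simpa [lowerBounds] using h

theorem osum_concat (l : List E) (x : E) : osum (l ++ [x]) = (osum l).bind (oplus · x) := by
  simp [osum, List.foldlM_append]

theorem osum_replicate_succ (n : ℕ) (x : E) :
    osum (List.replicate (n + 1) x) = (osum (List.replicate n x)).bind (oplus · x) := by
  rw [List.replicate_succ', osum_concat]

theorem osum_replicate_add {m n : ℕ} {x a b c : E} (ha : osum (List.replicate m x) = some a)
    (hb : osum (List.replicate n x) = some b) (h : oplus a b = some c) :
    osum (List.replicate (m + n) x) = some c := by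
  induction n generalizing b c with
  | zero =>
    obtain rfl : (0 : E) = b := Option.some.inj hb
    rw [oplus_zero] at h
    rw [← h]
    exact ha
  | succ n ih =>
    rw [osum_replicate_succ, Option.bind_eq_some_iff] at hb
    obtain ⟨b', hb', hbx⟩ := hb
    obtain ⟨d, hd, hd'⟩ := oplus_assoc_symm hbx h
    rw [← add_assoc, osum_replicate_succ, ih hb' hd]
    exact hd'

theorem exists_oplus_of_osum_replicate_add {m n : ℕ} {x a b c : E}
    (ha : osum (List.replicate m x) = some a) (hb : osum (List.replicate n x) = some b)
    (hc : osum (List.replicate (m + n) x) = some c) : oplus a b = some c := by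
  induction n generalizing b c with
  | zero =>
    obtain rfl : (0 : E) = b := Option.some.inj hb
    rw [oplus_zero, ← ha, ← hc, add_zero]
  | succ n ih =>
    rw [osum_replicate_succ, Option.bind_eq_some_iff] at hb
    rw [← add_assoc, osum_replicate_succ, Option.bind_eq_some_iff] at hc
    obtain ⟨b', hb', hbx⟩ := hb
    obtain ⟨c', hc', hcx⟩ := hc
    obtain ⟨f, hf, hf'⟩ := oplus_assoc _ _ _ _ _ (ih hb' hc') hcx
    rw [hbx] at hf
    cases hf
    exact hf'

theorem osum_replicate_of_le {m n : ℕ} (hmn : m ≤ n) {x b : E}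
    (hb : osum (List.replicate n x) = some b) : ∃ a, osum (List.replicate m x) = some a := by
  induction n, hmn using Nat.le_induction generalizing b with
  | base => exact ⟨b, hb⟩
  | succ n _ ih =>
    rw [osum_replicate_succ, Option.bind_eq_some_iff] at hb
    obtain ⟨b', hb', _⟩ := hb
    exact ih hb'


theorem IsAdditive.map_zero {J : E → E} (hJ : IsAdditive J) : J 0 = 0 :=
  oplus_cancel (hJ _ _ _ (oplus_zero 0)) (oplus_zero (J 0))

theorem IsAdditive.monotone {J : E → E} (hJ : IsAdditive J) : Monotone J :=
  fun _ _ ⟨_, hc⟩ => le_of_oplus_left (hJ _ _ _ hc)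

theorem IsAdditive.osum_replicate {J : E → E} (hJ : IsAdditive J) {n : ℕ} {x a : E}
    (h : osum (List.replicate n x) = some a) : osum (List.replicate n (J x)) = some (J a) := by
  induction n generalizing a with
  | zero =>
    obtain rfl : (0 : E) = a := Option.some.inj h
    rw [hJ.map_zero]
    rfl
  | succ n ih =>
    rw [osum_replicate_succ, Option.bind_eq_some_iff] at h
    obtain ⟨b, hb, hbx⟩ := h
    rw [osum_replicate_succ, ih hb]
    exact hJ _ _ _ hbx

theorem MackeyCompatible.symm {a b : E} (h : MackeyCompatible a b) : MackeyCompatible b a := by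
  obtain ⟨a₁, b₁, c, d, e, h₁, h₂, h₃, h₄⟩ := h
  exact ⟨b₁, a₁, c, d, e, oplus_comm _ _ _ h₁, h₂, h₄, h₃⟩

end EffectAlgebra

namespace CompressionBase

open EffectAlgebra

variable {E : Type u} [EffectAlgebra E] (K : CompressionBase E)

/-! ### Projections, commutants and composition of compressions. -/

section Projections

variable {K} {p q r s : E}

theorem J_additive (hp : p ∈ K.P) : IsAdditive (K.J p) :=
  (K.isCompression p hp).isRetraction.additive

theorem J_mono (hp : p ∈ K.P) : Monotone (K.J p) := (J_additive hp).monotone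

theorem J_le (hp : p ∈ K.P) (a : E) : K.J p a ≤ p := by
  simpa [K.focus p hp] using J_mono hp (le_one' a)

theorem J_of_le (hp : p ∈ K.P) {a : E} (h : a ≤ p) : K.J p a = a :=
  (K.isCompression p hp).isRetraction.apply_eq a (by rwa [K.focus p hp])

theorem J_eq_zero_iff (hp : p ∈ K.P) {a : E} : K.J p a = 0 ↔ a ≤ pᶜ := by
  rw [(K.isCompression p hp).apply_eq_zero_iff, K.focus p hp]

theorem compl_mem (hp : p ∈ K.P) : pᶜ ∈ K.P := K.isSubEffectAlgebra.compl_mem p hp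

theorem J_compl_eq_zero (hp : p ∈ K.P) {a : E} (h : a ≤ p) : K.J pᶜ a = 0 := by
  rwa [J_eq_zero_iff (compl_mem hp), compl_compl']

theorem J_oplus_J_compl (hp : p ∈ K.P) (a : E) : oplus (K.J p a) (K.J p aᶜ) = some p := by
  simpa [K.focus p hp] using J_additive hp _ _ _ (oplus_compl a)

/-- `J_p` fixes both summands, hence also their sum, and its values lie below `p`. Thus a sum of
elements below a projection stays below it; this fails for general upper bounds. -/
theorem oplus_le (hp : p ∈ K.P) {a b c : E} (ha : a ≤ p) (hb : b ≤ p)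
    (h : oplus a b = some c) : c ≤ p := by
  have := J_additive hp _ _ _ h
  rw [J_of_le hp ha, J_of_le hp hb, h] at this
  rw [Option.some.inj this]
  exact J_le hp c

theorem ominus_mem (hp : p ∈ K.P) (hq : q ∈ K.P) {r : E} (h : oplus p r = some q) : r ∈ K.P := by
  obtain ⟨f, hf, hf'⟩ := oplus_assoc r p qᶜ q 1 (oplus_comm _ _ _ h) (oplus_compl q)
  have hfP := K.isSubEffectAlgebra.oplus_mem _ hp _ (compl_mem hq) _ hf
  rw [eq_compl (oplus_comm _ _ _ hf')]
  exact compl_mem hfP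

theorem mem_commutant_compl {a : E} : a ∈ K.commutant pᶜ ↔ a ∈ K.commutant p := by
  simp only [commutant, Set.mem_ofPred_eq, compl_compl']
  exact ⟨oplus_comm _ _ _, oplus_comm _ _ _⟩

theorem mem_commutant_of_le (hp : p ∈ K.P) {a : E} (h : a ≤ p) : a ∈ K.commutant p := by
  rw [commutant, Set.mem_ofPred_eq, J_of_le hp h, J_compl_eq_zero hp h, oplus_zero]

theorem J_le_self {a : E} (h : a ∈ K.commutant p) : K.J p a ≤ a := le_of_oplus_left h

theorem commutant_of_oplus_right (hp : p ∈ K.P) {x y z : E} (h : oplus x y = some z)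
    (hy : y ∈ K.commutant p) (hz : z ∈ K.commutant p) : x ∈ K.commutant p := by
  obtain ⟨f, g, hf, hg, hfg⟩ := oplus_oplus_oplus_comm (J_additive hp _ _ _ h)
    (J_additive (compl_mem hp) _ _ _ h) hz
  rw [show oplus _ _ = some y from hy] at hg
  cases hg
  exact hf.trans (congrArg some (oplus_cancel_right hfg h))

theorem compl_mem_commutant (hp : p ∈ K.P) {a : E} (h : a ∈ K.commutant p) :
    aᶜ ∈ K.commutant p := by
  refine commutant_of_oplus_right hp (compl_oplus a) h ?_
  rw [commutant, Set.mem_ofPred_eq, K.focus p hp, K.focus _ (compl_mem hp), oplus_compl]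

theorem mackeyCompatible_of_mem_commutant (hp : p ∈ K.P) (h : q ∈ K.commutant p) :
    MackeyCompatible p q := by
  obtain ⟨x, hx⟩ := J_le hp q
  obtain ⟨z, hz⟩ := le_compl_iff.1 (J_le (compl_mem hp) q)
  obtain ⟨f, hf, hf'⟩ := oplus_assoc_symm (oplus_comm _ _ _ hx) hz
  exact ⟨x, K.J pᶜ q, K.J p q, f, z, oplus_comm _ _ _ hf, hf', oplus_comm _ _ _ hx,
    oplus_comm _ _ _ h⟩

theorem mem_commutant_of_mackeyCompatible (hp : p ∈ K.P) (h : MackeyCompatible p q) :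
    q ∈ K.commutant p := by
  obtain ⟨a₁, b₁, c, d, e, h₁, h₂, h₃, h₄⟩ := h
  have hc : c ≤ p := le_of_oplus_right h₃
  have hb : b₁ ≤ pᶜ := by
    obtain ⟨f, hf, hf'⟩ := oplus_assoc b₁ a₁ c d e (oplus_comm _ _ _ h₁) h₂
    rw [h₃] at hf
    cases hf
    exact le_compl_iff.2 ⟨_, hf'⟩
  have h₅ := J_additive hp _ _ _ h₄
  rw [(J_eq_zero_iff hp).2 hb, zero_oplus, J_of_le hp hc] at h₅
  have h₆ := J_additive (compl_mem hp) _ _ _ h₄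
  rw [J_of_le (compl_mem hp) hb, J_compl_eq_zero hp hc, oplus_zero] at h₆
  rw [commutant, Set.mem_ofPred_eq, ← Option.some.inj h₅, ← Option.some.inj h₆]
  exact oplus_comm _ _ _ h₄

theorem mackeyCompatible_iff (hp : p ∈ K.P) : MackeyCompatible p q ↔ q ∈ K.commutant p :=
  ⟨mem_commutant_of_mackeyCompatible hp, mackeyCompatible_of_mem_commutant hp⟩

theorem mem_commutant_comm (hp : p ∈ K.P) (hq : q ∈ K.P) :
    q ∈ K.commutant p ↔ p ∈ K.commutant q := by
  rw [← mackeyCompatible_iff hp, ← mackeyCompatible_iff hq]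
  exact ⟨.symm, .symm⟩

/-- Evaluating `J_p ∘ J_q = J_r` at `1` identifies `r` as `J_p(q)`. -/
theorem J_apply_mem (hp : p ∈ K.P) (hq : q ∈ K.P) (h : q ∈ K.commutant p) :
    K.J p q ∈ K.P ∧ ∀ x, K.J p (K.J q x) = K.J (K.J p q) x := by
  obtain ⟨r, hr, hc⟩ := K.comp p hp q hq ((mackeyCompatible_iff hp).2 h)
  have h₁ : K.J p q = r := by
    have := congrFun hc 1
    rwa [Function.comp_apply, K.focus q hq, K.focus r hr] at this
  rw [h₁]
  exact ⟨hr, congrFun hc⟩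

theorem isGLB_J (hp : p ∈ K.P) (hq : q ∈ K.P) (h : q ∈ K.commutant p) :
    IsGLB {p, q} (K.J p q) := by
  obtain ⟨hr, hc⟩ := J_apply_mem hp hq h
  refine ⟨?_, fun x hx => ?_⟩
  · simpa [lowerBounds] using And.intro (J_le hp q) (J_le_self h)
  · have hxp : x ≤ p := hx (by simp)
    have hxq : x ≤ q := hx (by simp)
    have := hc x
    rw [J_of_le hq hxq, J_of_le hp hxp] at this
    rw [this]
    exact J_le hr x

theorem J_comm_apply (hp : p ∈ K.P) (hq : q ∈ K.P) (h : q ∈ K.commutant p) :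
    K.J p q = K.J q p := by
  have h₁ := isGLB_J hq hp ((mem_commutant_comm hp hq).1 h)
  rw [Set.pair_comm] at h₁
  exact (isGLB_J hp hq h).unique h₁

theorem J_comm (hp : p ∈ K.P) (hq : q ∈ K.P) (h : q ∈ K.commutant p) (x : E) :
    K.J p (K.J q x) = K.J q (K.J p x) := by
  rw [(J_apply_mem hp hq h).2, (J_apply_mem hq hp ((mem_commutant_comm hp hq).1 h)).2,
    J_comm_apply hp hq h]

theorem J_J_of_le (hp : p ∈ K.P) (hq : q ∈ K.P) (h : q ≤ p) (x : E) :
    K.J q (K.J p x) = K.J q x := by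
  have hc := mem_commutant_of_le hp h
  rw [← J_comm hp hq hc, (J_apply_mem hp hq hc).2, J_of_le hp h]

/-- Inside `s` the complement of `p` is `q`, that is `J_s(p') = q`, so `J_s ∘ J_{p'} = J_q`.
Applying `J_s` to `x = J_p(x) ⊕ J_{p'}(x)` gives the claim. -/
theorem J_oplus (hp : p ∈ K.P) (hq : q ∈ K.P) (h : oplus p q = some s) {x : E}
    (hx : x ∈ K.commutant p) : oplus (K.J p x) (K.J q x) = some (K.J s x) := by
  have hs : s ∈ K.P := K.isSubEffectAlgebra.oplus_mem _ hp _ hq _ h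
  have hps := le_of_oplus_left h
  have hqs := le_of_oplus_right h
  have hc : pᶜ ∈ K.commutant s := compl_mem_commutant hs (mem_commutant_of_le hs hps)
  have hq' : K.J s pᶜ = q := by
    have h₁ := J_oplus_J_compl hs p
    rw [J_of_le hs hps] at h₁
    exact oplus_cancel h₁ h
  have h₂ := J_additive hs _ _ _ hx
  rwa [(J_apply_mem hs (compl_mem hp) hc).2, hq', J_of_le hs ((J_le hp x).trans hps)] at h₂

theorem J_mem_commutant (hp : p ∈ K.P) (hq : q ∈ K.P) (h : q ∈ K.commutant p) {x : E}
    (hx : x ∈ K.commutant p) : K.J q x ∈ K.commutant p := by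
  have hq' := mem_commutant_compl.2 h
  rw [commutant, Set.mem_ofPred_eq, J_comm hp hq h, J_comm (compl_mem hp) hq hq']
  exact J_additive hq _ _ _ hx

end Projections

/-! ### Projection covers. -/

namespace IsProjectionCover

variable {K} {a b p q : E}

theorem unique (h : K.IsProjectionCover a p) (h' : K.IsProjectionCover a q) : p = q :=
  le_antisymm ((h.2 q h'.1).1 ((h'.2 q h'.1).2 le_rfl)) ((h'.2 p h.1).1 ((h.2 p h.1).2 le_rfl))

theorem le (h : K.IsProjectionCover a p) : a ≤ p := (h.2 p h.1).2 le_rfl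

theorem cover_eq (h : K.IsProjectionCover a p) : K.cover a = p := by
  have hex : ∃ p, K.IsProjectionCover a p := ⟨p, h⟩
  rw [cover, dif_pos hex]
  exact hex.choose_spec.unique h

theorem oplus_self (h : K.IsProjectionCover a p) (hb : oplus a a = some b) :
    K.IsProjectionCover b p :=
  ⟨h.1, fun q hq => ⟨fun hbq => (h.2 q hq).1 ((le_of_oplus_left hb).trans hbq), fun hpq =>
    oplus_le hq ((h.2 q hq).2 hpq) ((h.2 q hq).2 hpq) hb⟩⟩

/-- The covers of `J_q(a)` and `J_{q'}(a)` lie below `q` and `q'`, and their sum is the cover of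
`a`; so that cover splits along `q`. -/
theorem mem_commutant (hK : K.IsSpectral) (h : K.IsProjectionCover a p) (hq : q ∈ K.P)
    (ha : a ∈ K.commutant q) : p ∈ K.commutant q := by
  obtain ⟨k, hk⟩ := hK.exists_cover (K.J q a)
  obtain ⟨l, hl⟩ := hK.exists_cover (K.J qᶜ a)
  have hkq : k ≤ q := (hk.2 q hq).1 (J_le hq a)
  have hlq : l ≤ qᶜ := (hl.2 _ (compl_mem hq)).1 (J_le (compl_mem hq) a)
  obtain ⟨e, he, -⟩ := oplus_mono hkq hlq (oplus_compl q)
  have heP := K.isSubEffectAlgebra.oplus_mem _ hk.1 _ hl.1 _ he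
  have hcov : K.IsProjectionCover a e := by
    refine ⟨heP, fun r hr => ⟨fun har => ?_, fun her => ?_⟩⟩
    · exact oplus_le hr ((hk.2 r hr).1 ((le_of_oplus_left ha).trans har))
        ((hl.2 r hr).1 ((le_of_oplus_right ha).trans har)) he
    · exact (oplus_le_oplus hk.le hl.le ha he).trans her
  rw [h.unique hcov]
  have h₁ := J_additive hq _ _ _ he
  rw [J_of_le hq hkq, (J_eq_zero_iff hq).2 hlq, oplus_zero] at h₁
  have h₂ := J_additive (compl_mem hq) _ _ _ he
  rw [J_of_le (compl_mem hq) hlq, J_compl_eq_zero hq hkq, zero_oplus] at h₂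
  rw [commutant, Set.mem_ofPred_eq, ← Option.some.inj h₁, ← Option.some.inj h₂]
  exact he

/-- If `u₀ ⊕ u₁` is the projection cover of `c ∈ C(u₀)`, then `u₀` is that of `J_{u₀}(c)`. -/
theorem J_left (hK : K.IsSpectral) {c u u₀ u₁ : E} (h : K.IsProjectionCover c u)
    (h₀ : u₀ ∈ K.P) (h₁ : u₁ ∈ K.P) (hu : oplus u₀ u₁ = some u)
    (hc : c ∈ K.commutant u₀) : K.IsProjectionCover (K.J u₀ c) u₀ := by
  obtain ⟨k, hk⟩ := hK.exists_cover (K.J u₀ c)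
  have hku : k ≤ u₀ := (hk.2 u₀ h₀).1 (J_le h₀ c)
  -- With `k` the cover of `J_{u₀}(c)`, the projection `e = k ⊕ u₁` dominates `c`, hence `u`.
  -- Compressing `u₀ ≤ e` by `J_{u₀}` kills `u₁` and leaves `u₀ ≤ k`.
  obtain ⟨e, he, -⟩ := oplus_mono hku le_rfl hu
  have heP := K.isSubEffectAlgebra.oplus_mem _ hk.1 _ h₁ _ he
  have hsum := J_oplus h₀ h₁ hu hc
  rw [J_of_le h.1 h.le] at hsum
  have hue : u ≤ e := (h.2 e heP).1 (oplus_le_oplus hk.le (J_le h₁ c) hsum he)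
  have h₂ : u₀ ≤ k := by
    have h₃ := J_additive h₀ _ _ _ he
    have h₄ : u₁ ≤ u₀ᶜ := le_compl_iff.2 ⟨_, oplus_comm _ _ _ hu⟩
    rw [J_of_le h₀ hku, (J_eq_zero_iff h₀).2 h₄, oplus_zero] at h₃
    have h₅ := J_mono h₀ ((le_of_oplus_left hu).trans hue)
    rwa [J_of_le h₀ le_rfl, ← Option.some.inj h₃] at h₅
  rwa [le_antisymm hku h₂] at hk

end IsProjectionCover

/-! ### Consequences of b-comparability; the positive part. -/

section Comparability

variable {K}

theorem mem_commutant_of_isBooleanSubalgebra {B : Set E} (hBP : B ⊆ K.P)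
    (hB : IsBooleanSubalgebra B) {p q : E} (hp : p ∈ B) (hq : q ∈ B) : q ∈ K.commutant p := by
  obtain ⟨A, _, φ, hφ⟩ := hB.isBoolean
  obtain ⟨x, hx⟩ := φ.surjective ⟨p, hp⟩
  obtain ⟨y, hy⟩ := φ.surjective ⟨q, hq⟩
  have hxp : (φ x : E) = p := by rw [hx]
  have hyq : (φ y : E) = q := by rw [hy]
  have hle : ∀ {z w : A}, z ≤ w → (φ z : E) ≤ φ w := fun h => φ.monotone h
  -- The Boolean decomposition of `z` along `w` is also a sum in `E`: the sum lies in `B`, so it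
  -- dominates the Boolean join, while `oplus_le` bounds it by `z`.
  have key : ∀ z w : A, oplus (φ (z ⊓ wᶜ) : E) (φ (z ⊓ w)) = some (φ z : E) := by
    intro z w
    have h₁ : (φ (z ⊓ wᶜ) : E) ≤ (φ (z ⊓ w) : E)ᶜ := by
      rw [← hφ]
      exact hle (inf_le_right.trans (compl_le_compl inf_le_right))
    obtain ⟨c, hc⟩ := le_compl_iff.1 h₁
    have hcB := hB.isSubEffectAlgebra.oplus_mem _ (φ _).2 _ (φ _).2 _ hc
    obtain ⟨t, ht⟩ := φ.surjective ⟨c, hcB⟩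
    have htc : (φ t : E) = c := by rw [ht]
    have h₂ : z ⊓ wᶜ ≤ t := φ.le_iff_le.1 (show (φ _ : E) ≤ φ t by
      rw [htc]; exact le_of_oplus_left hc)
    have h₃ : z ⊓ w ≤ t := φ.le_iff_le.1 (show (φ _ : E) ≤ φ t by
      rw [htc]; exact le_of_oplus_right hc)
    have h₄ : z ≤ t := by
      rw [← sup_inf_inf_compl (x := z) (y := w)]
      exact sup_le h₃ h₂
    have h₅ : c ≤ φ z := oplus_le (hBP (φ z).2) (hle inf_le_left) (hle inf_le_left) hc
    rw [hc, le_antisymm h₅ (htc ▸ hle h₄)]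
  have hxy := key x y
  have hyx := key y x
  rw [inf_comm y x] at hyx
  have h₁ : (φ (x ⊓ yᶜ) : E) ≤ (φ y : E)ᶜ := by
    rw [← hφ]
    exact hle inf_le_right
  obtain ⟨e, he⟩ := le_compl_iff.1 h₁
  obtain ⟨d, hd, hd'⟩ := oplus_assoc_symm hyx he
  rw [← mackeyCompatible_iff (hBP hp), ← hxp, ← hyq]
  exact ⟨_, _, _, d, e, hd, hd', hxy, hyx⟩

/-- A projection commuting with all projections that commute with `a` commutes with `a`. -/
theorem mem_commutant_of_PC (hK : K.IsSpectral) {a p : E} (hp : p ∈ K.P)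
    (h : K.PC {a} ⊆ K.commutant p) : a ∈ K.commutant p := by
  obtain ⟨B, hBP, hB, hBa⟩ := hK.bComparability.isBElement a
  -- Members of `B` commute with one another, so they commute with `a`; hence `B ⊆ PC {a}`.
  refine (hBa p hp).2 fun b hb => h ⟨hBP hb, ?_⟩
  rw [Set.singleton_subset_iff, hBa b (hBP hb)]
  exact fun c hc => mem_commutant_of_isBooleanSubalgebra hBP hB hb hc

/-- This is the independence of the chosen projection. For `r`, `s` in `P_≤(a,b)`, the difference
`x` formed with `r` satisfies `J_{s'}(x) = 0`, because `J_{s'}(b) ≤ J_{s'}(a)`. So `x ≤ s`, and `x`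
is also the difference formed with `J_s ∘ J_r`, which is symmetric in `r` and `s`. -/
theorem posPart_spec {a b r : E} (hr : r ∈ K.Ple a b) :
    oplus (K.posPart b a) (K.J r a) = some (K.J r b) := by
  have key : ∀ {r s x : E}, r ∈ K.Ple a b → s ∈ K.Ple a b → oplus x (K.J r a) = some (K.J r b) →
      oplus x (K.J s (K.J r a)) = some (K.J s (K.J r b)) := by
    rintro r s x ⟨⟨hrP, hrC⟩, hr⟩ ⟨⟨hsP, hsC⟩, hs⟩ hx
    have hsr : r ∈ K.commutant s := hsC (Or.inl ⟨hrP, fun y hy => hrC (Or.inr hy)⟩)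
    have h₁ := J_additive (compl_mem hsP) _ _ _ hx
    have hsr' := mem_commutant_compl.2 hsr
    rw [J_comm (compl_mem hsP) hrP hsr', J_comm (compl_mem hsP) hrP hsr'] at h₁
    have h₂ : K.J r (K.J sᶜ b) = K.J r (K.J sᶜ a) :=
      le_antisymm (J_mono hrP hs.2) (le_of_oplus_right h₁)
    rw [h₂] at h₁
    have h₃ : x ≤ s := by
      rw [← compl_compl' s, ← J_eq_zero_iff (compl_mem hsP)]
      exact oplus_cancel_right h₁ (zero_oplus _)
    have h₄ := J_additive hsP _ _ _ hx
    rwa [J_of_le hsP h₃] at h₄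
  have hne : (K.Ple a b).Nonempty := ⟨r, hr⟩
  have h₁ : oplus (K.posPart b a) (K.J hne.choose a) = some (K.J hne.choose b) := by
    rw [posPart, dif_pos hne]
    exact oplus_comm _ _ _ (oplus_ominus hne.choose_spec.2.1)
  have h₂ := oplus_comm _ _ _ (oplus_ominus hr.2.1)
  have h₃ := key hne.choose_spec hr h₁
  have h₄ := key hr hne.choose_spec h₂
  have hc : hne.choose ∈ K.commutant r :=
    hr.1.2 (Or.inl ⟨hne.choose_spec.1.1, fun y hy => hne.choose_spec.1.2 (Or.inr hy)⟩)
  rw [← J_comm hr.1.1 hne.choose_spec.1.1 hc, ← J_comm hr.1.1 hne.choose_spec.1.1 hc] at h₄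
  rwa [oplus_cancel_right h₃ h₄]

theorem posPart_mem_commutant {a b r q : E} (hr : r ∈ K.Ple a b) (hq : q ∈ K.PC {a, b}) :
    K.posPart b a ∈ K.commutant q := by
  have hrq : r ∈ K.commutant q := (mem_commutant_comm hr.1.1 hq.1).1 (hr.1.2 (Or.inl hq))
  exact commutant_of_oplus_right hq.1 (posPart_spec hr)
    (J_mem_commutant hq.1 hr.1.1 hrq (hq.2 (by simp)))
    (J_mem_commutant hq.1 hr.1.1 hrq (hq.2 (by simp)))

theorem PC_pair_compl (c : E) : K.PC {cᶜ, c} = K.PC {c} := by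
  ext p
  simp only [PC, Set.mem_ofPred_eq, Set.insert_subset_iff, Set.singleton_subset_iff]
  exact ⟨fun h => ⟨h.1, h.2.2⟩, fun h => ⟨h.1, compl_mem_commutant h.1 h.2, h.2⟩⟩

theorem PC_singleton_compl (c : E) : K.PC {cᶜ} = K.PC {c} := by
  rw [← PC_pair_compl c, Set.pair_comm, ← PC_pair_compl cᶜ, compl_compl']

theorem mem_bicommutant_pair_compl {c p : E} (hp : p ∈ K.P) (h : K.PC {c} ⊆ K.commutant p)
    (hc : c ∈ K.commutant p) : p ∈ K.bicommutant {c, cᶜ} := by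
  refine ⟨hp, Set.union_subset ?_ ?_⟩
  · rwa [Set.pair_comm, PC_pair_compl]
  · simpa [Set.insert_subset_iff] using And.intro hc (compl_mem_commutant hp hc)

theorem commutes_compl (c : E) : K.Commutes cᶜ c := by
  intro p hp q hq
  rw [mackeyCompatible_iff hp.1]
  refine hp.2 (Or.inl ?_)
  rw [PC_singleton_compl]
  exact ⟨hq.1, fun y hy => hq.2 (Or.inr hy)⟩

theorem ple_compl_nonempty (hK : K.IsSpectral) (c : E) : (K.Ple cᶜ c).Nonempty :=
  hK.bComparability.ple_nonempty _ _ (commutes_compl c)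

end Comparability

/-! ### The splitting step. -/

/-- One splitting step applied to an element `c` with projection cover `u`. -/
structure IsSplitting (c u c₀ u₀ c₁ u₁ : E) : Prop where
  cover_zero : K.IsProjectionCover c₀ u₀
  cover_one : K.IsProjectionCover c₁ u₁
  oplus_eq : oplus u₀ u₁ = some u
  double : oplus (K.J u₀ c) (K.J u₀ c) = some c₀
  eq_of_le : c ≤ cᶜ → u₀ = u

/-- The key point is that `u₁'` itself belongs to `P_≤(c,c')`, so it computes `e = (c' - c)₊`.
Compressing by `u` gives `J_{u₀}(c') = (e ∧ u) ⊕ J_{u₀}(c)`; adding `J_{u₀}(c)` gives `u₀ = (e ∧ u)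
⊕ 2 J_{u₀}(c)`. -/
theorem isSplitting_splitStep (hK : K.IsSpectral) {c u : E} (h : K.IsProjectionCover c u) :
    K.IsSplitting c u (K.splitStep (c, u) false).1 (K.splitStep (c, u) false).2
      (K.splitStep (c, u) true).1 (K.splitStep (c, u) true).2 := by
  obtain ⟨p, hp⟩ := ple_compl_nonempty hK c
  have hu := h.1
  have hpP := hp.1.1
  have hcp : c ∈ K.commutant p := hp.1.2 (Or.inr (by simp))
  have hcp' : cᶜ ∈ K.commutant p := hp.1.2 (Or.inr (by simp))
  obtain ⟨d, hd⟩ : ∃ d, d = K.posPart c cᶜ := ⟨_, rfl⟩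
  have hdp : oplus d (K.J p cᶜ) = some (K.J p c) := hd ▸ posPart_spec hp
  have hdC : ∀ q ∈ K.PC {c}, d ∈ K.commutant q := fun q hq =>
    hd ▸ posPart_mem_commutant hp (by rwa [PC_pair_compl])
  have hdc : d ≤ c := (le_of_oplus_left hdp).trans (J_le_self hcp)
  have hdu : d ≤ u := hdc.trans h.le
  obtain ⟨u₁, hu₁⟩ := hK.exists_cover d
  have hu₁P := hu₁.1
  have hu₁u : u₁ ≤ u := (hu₁.2 u hu).1 hdu
  have hu₁p : u₁ ≤ p := (hu₁.2 p hpP).1 ((le_of_oplus_left hdp).trans (J_le hpP c))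
  have hu₁C : K.PC {c} ⊆ K.commutant u₁ := fun q hq =>
    (mem_commutant_comm hq.1 hu₁P).1 (hu₁.mem_commutant hK hq.1 (hdC q hq))
  have hcu₁ : c ∈ K.commutant u₁ := mem_commutant_of_PC hK hu₁P hu₁C
  have hsP := compl_mem hu₁P
  -- On `p` the elements `c` and `c'` differ by `d`, which `J_{u₁'}` kills; on `p'` already `c` is
  -- below `c'`. For the other inequality use `u₁ ≤ p`.
  have hs : u₁ᶜ ∈ K.Ple c cᶜ := by
    refine ⟨mem_bicommutant_pair_compl hsP (fun q hq => mem_commutant_compl.2 (hu₁C hq))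
      (mem_commutant_compl.2 hcu₁), ?_, ?_⟩
    · have h₁ := J_additive hsP _ _ _ hdp
      rw [J_compl_eq_zero hu₁P hu₁.le, zero_oplus] at h₁
      refine oplus_le_oplus (Option.some.inj h₁).ge (J_mono hsP hp.2.2)
        (J_additive hsP _ _ _ hcp) (J_additive hsP _ _ _ hcp')
    · rw [compl_compl', ← J_J_of_le hpP hu₁P hu₁p, ← J_J_of_le hpP hu₁P hu₁p c]
      exact J_mono hu₁P hp.2.1
  obtain ⟨u₀, hu₀⟩ := hu₁u
  have hu₀P := ominus_mem hu₁P hu hu₀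
  have hus : u₁ᶜ ∈ K.commutant u :=
    compl_mem_commutant hu (mem_commutant_of_le hu (le_of_oplus_left hu₀))
  have hJus : K.J u u₁ᶜ = u₀ := by
    have h₁ := J_oplus_J_compl hu u₁
    rw [J_of_le hu (le_of_oplus_left hu₀)] at h₁
    exact oplus_cancel h₁ hu₀
  have hmeet₀ : meet u₁ᶜ u = u₀ := meet_eq (by
    rw [Set.pair_comm, ← hJus]; exact isGLB_J hu hsP hus)
  have hu₀u := le_of_oplus_right hu₀
  have hmeet₁ : meet u u₀ᶜ = u₁ := by
    have h₁ : K.J u u₀ᶜ = u₁ := by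
      have h₁ := J_oplus_J_compl hu u₀
      rw [J_of_le hu hu₀u] at h₁
      exact oplus_cancel h₁ (oplus_comm _ _ _ hu₀)
    refine meet_eq ?_
    rw [← h₁]
    exact isGLB_J hu (compl_mem hu₀P) (compl_mem_commutant hu (mem_commutant_of_le hu hu₀u))
  obtain ⟨e, he⟩ : ∃ e, e = K.posPart cᶜ c := ⟨_, rfl⟩
  have heu : e ∈ K.commutant u := he ▸ posPart_mem_commutant hs (by
    rw [Set.pair_comm, PC_pair_compl]
    exact ⟨hu, Set.singleton_subset_iff.2 (mem_commutant_of_le hu h.le)⟩)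
  have hmeet : meet e u = K.J u e := by
    refine meet_eq ⟨?_, fun x hx => ?_⟩
    · simpa [lowerBounds] using And.intro (J_le_self heu) (J_le hu e)
    · rw [← J_of_le hu (show x ≤ u from hx (by simp))]
      exact J_mono hu (hx (by simp))
  have hes := J_additive hu _ _ _ (he ▸ posPart_spec hs : oplus e _ = _)
  rw [(J_apply_mem hu hsP hus).2, (J_apply_mem hu hsP hus).2, hJus] at hes
  obtain ⟨c₀, hc₀, hec₀⟩ := oplus_assoc _ _ _ _ _ hes
    (oplus_comm _ _ _ (J_oplus_J_compl hu₀P c))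
  have hcu₀ : c ∈ K.commutant u₀ := by
    refine mem_commutant_of_PC hK hu₀P fun q hq => ?_
    have hqu : u ∈ K.commutant q := h.mem_commutant hK hq.1 (hq.2 rfl)
    exact (mem_commutant_comm hq.1 hu₀P).1 (commutant_of_oplus_right hq.1
      (oplus_comm _ _ _ hu₀) ((mem_commutant_comm hu₁P hq.1).1 (hu₁C hq)) hqu)
  have hf : K.splitStep (c, u) false = (c₀, u₀) := by
    simp only [splitStep, Bool.false_eq_true, if_false, ← hd, hu₁.cover_eq, hmeet₀, ← he, hmeet,
      ominus_eq hec₀]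
  have ht : K.splitStep (c, u) true = (d, u₁) := by
    simp only [splitStep, if_true, ← hd, hu₁.cover_eq, hmeet₀, hmeet₁,
      meet_eq (isGLB_pair_of_le hdu)]
  rw [hf, ht]
  refine ⟨(h.J_left hK hu₀P hu₁P (oplus_comm _ _ _ hu₀) hcu₀).oplus_self hc₀, hu₁,
    oplus_comm _ _ _ hu₀, hc₀, fun hcc => ?_⟩
  -- If `c ≤ c'`, the positive part `d` vanishes, so its cover `u₁` does too and nothing is split
  -- off.
  have hd0 : d = 0 := by
    have h₁ := le_antisymm (J_mono hpP hcc) (le_of_oplus_right hdp)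
    rw [h₁] at hdp
    exact oplus_cancel_right hdp (zero_oplus _)
  have h0 : u₁ = 0 :=
    le_zero_iff'.1 ((hu₁.2 0 K.isSubEffectAlgebra.zero_mem).1 hd0.le)
  rw [h0, zero_oplus] at hu₀
  exact Option.some.inj hu₀

end CompressionBase

/-! ### Binary words and the iterated splitting. -/

theorem binWord_two_mul (n k : ℕ) : binWord (n + 1) (2 * k) = binWord n k ++ [false] := by
  simp [binWord]

theorem binWord_two_mul_add_one (n k : ℕ) :
    binWord (n + 1) (2 * k + 1) = binWord n k ++ [true] := by
  have h : (2 * k + 1) / 2 = k := by omega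
  simp [binWord, h]

theorem binWord_mul_two_pow (n k j : ℕ) :
    binWord (n + j) (k * 2 ^ j) = binWord n k ++ List.replicate j false := by
  induction j with
  | zero => simp
  | succ j ih =>
    rw [show k * 2 ^ (j + 1) = 2 * (k * 2 ^ j) by ring, ← add_assoc, binWord_two_mul, ih,
      List.replicate_succ', List.append_assoc]

namespace CompressionBase

open EffectAlgebra

variable {E : Type u} [EffectAlgebra E] {K : CompressionBase E}

theorem isProjectionCover_cover (hK : K.IsSpectral) (a : E) :
    K.IsProjectionCover a (K.cover a) := by
  obtain ⟨p, hp⟩ := hK.exists_cover a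
  rwa [hp.cover_eq]

theorem cu_concat (a : E) (w : List Bool) (i : Bool) :
    K.cu a (w ++ [i]) = K.splitStep (K.cu a w) i := by
  simp [cu]

/-- The cover property is a hypothesis here because it is the induction hypothesis of
`isProjectionCover_cu`, which then removes it. -/
theorem isSplitting_cu_aux (hK : K.IsSpectral) {a : E} {w : List Bool}
    (h : K.IsProjectionCover (K.cu a w).1 (K.uProj a w)) :
    K.IsSplitting (K.cu a w).1 (K.uProj a w) (K.cu a (w ++ [false])).1 (K.uProj a (w ++ [false]))
      (K.cu a (w ++ [true])).1 (K.uProj a (w ++ [true])) := by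
  simp only [uProj, cu_concat]
  exact isSplitting_splitStep K hK h

theorem isProjectionCover_cu (hK : K.IsSpectral) (a : E) (w : List Bool) :
    K.IsProjectionCover (K.cu a w).1 (K.uProj a w) := by
  induction w using List.reverseRecOn with
  | nil => exact isProjectionCover_cover hK a
  | append_singleton w i ih =>
    cases i
    · exact (isSplitting_cu_aux hK ih).cover_zero
    · exact (isSplitting_cu_aux hK ih).cover_one

theorem isSplitting_cu (hK : K.IsSpectral) (a : E) (w : List Bool) :
    K.IsSplitting (K.cu a w).1 (K.uProj a w) (K.cu a (w ++ [false])).1 (K.uProj a (w ++ [false]))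
      (K.cu a (w ++ [true])).1 (K.uProj a (w ++ [true])) :=
  isSplitting_cu_aux hK (isProjectionCover_cu hK a w)

theorem uProj_mem (hK : K.IsSpectral) (a : E) (w : List Bool) : K.uProj a w ∈ K.P :=
  (isProjectionCover_cu hK a w).1

/-- The element `c_{w0…0}`, with `j` zeros, is `2 ^ j` times the restriction of `c_w` to
`u_{w0…0}`. -/
theorem osum_replicate_J_cu (hK : K.IsSpectral) (a : E) (w : List Bool) (j : ℕ) :
    osum (List.replicate (2 ^ j) (K.J (K.uProj a (w ++ List.replicate j false)) (K.cu a w).1)) =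
      some (K.cu a (w ++ List.replicate j false)).1 := by
  induction j with
  | zero =>
    have h := isProjectionCover_cu hK a w
    simp only [List.replicate_zero, List.append_nil, pow_zero, List.replicate_one]
    rw [J_of_le h.1 h.le]
    simp [osum, zero_oplus]
  | succ j ih =>
    have h := isSplitting_cu hK a (w ++ List.replicate j false)
    rw [List.append_assoc, ← List.replicate_succ'] at h
    -- Compressing the previous multiple to the smaller projection keeps `2 ^ j` copies; `h.double`
    -- then adds two such blocks.
    have h₁ := (J_additive h.cover_zero.1).osum_replicate ih
    rw [J_J_of_le (uProj_mem hK _ _) h.cover_zero.1 (le_of_oplus_left h.oplus_eq)] at h₁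
    rw [pow_succ, mul_two]
    exact osum_replicate_add h₁ h₁ h.double

/-! ### Level sums and the values of the resolution. -/

variable (K) in
/-- The sum of `(a°)'` and of the projections `u_v` for the first `m` strings `v` of length `n`. -/
noncomputable def levelSum (a : E) (n m : ℕ) : Option E :=
  osum ((K.cover a)ᶜ :: (List.range m).map fun j => K.uProj a (binWord n j))

variable (K) in
/-- The value of the sum `levelSum`. -/
noncomputable def levelProj (a : E) (n m : ℕ) : E := (K.levelSum a n m).getD 0

theorem levelSum_zero_right (a : E) (n : ℕ) : K.levelSum a n 0 = some (K.cover a)ᶜ := by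
  simp [levelSum, osum, zero_oplus]

theorem levelSum_succ_right (a : E) (n m : ℕ) :
    K.levelSum a n (m + 1) = (K.levelSum a n m).bind (oplus · (K.uProj a (binWord n m))) := by
  rw [levelSum, List.range_succ, List.map_append, ← List.cons_append]
  exact osum_concat _ _

/-- Each `u_v` is refined into `u_{v0} ⊕ u_{v1}`, and these two words are consecutive at the next
level. -/
theorem levelSum_two_mul (hK : K.IsSpectral) (a : E) {n m : ℕ} {x : E}
    (h : K.levelSum a n m = some x) : K.levelSum a (n + 1) (2 * m) = some x := by
  induction m generalizing x with
  | zero => rwa [mul_zero, levelSum_zero_right, ← levelSum_zero_right a n]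
  | succ m ih =>
    rw [levelSum_succ_right, Option.bind_eq_some_iff] at h
    obtain ⟨y, hy, hyx⟩ := h
    have hs := (isSplitting_cu hK a (binWord n m)).oplus_eq
    rw [← binWord_two_mul, ← binWord_two_mul_add_one] at hs
    obtain ⟨z, hz, hzx⟩ := oplus_assoc_symm hs hyx
    rw [show 2 * (m + 1) = 2 * m + 1 + 1 by ring, levelSum_succ_right, levelSum_succ_right, ih hy,
      Option.bind_some, hz]
    exact hzx

theorem levelSum_two_pow (hK : K.IsSpectral) (a : E) (n : ℕ) :
    K.levelSum a n (2 ^ n) = some 1 := by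
  induction n with
  | zero =>
    rw [pow_zero, ← zero_add 1, levelSum_succ_right, levelSum_zero_right]
    exact compl_oplus _
  | succ n ih =>
    rw [pow_succ']
    exact levelSum_two_mul hK a ih

/-- The full sum of a level is defined (it equals `1`), hence so is each of its initial segments. -/
theorem levelSum_eq_some (hK : K.IsSpectral) (a : E) {n m : ℕ} (h : m ≤ 2 ^ n) :
    K.levelSum a n m = some (K.levelProj a n m) := by
  obtain ⟨x, hx⟩ : ∃ x, K.levelSum a n m = some x := by
    refine Nat.decreasingInduction (motive := fun m _ => ∃ x, K.levelSum a n m = some x)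
      (fun k _ hk => ?_) ⟨1, levelSum_two_pow hK a n⟩ h
    obtain ⟨x, hx⟩ := hk
    rw [levelSum_succ_right, Option.bind_eq_some_iff] at hx
    obtain ⟨y, hy, _⟩ := hx
    exact ⟨y, hy⟩
  simp [levelProj, hx]

theorem levelProj_eq_of_levelSum {a x : E} {n m : ℕ} (h : K.levelSum a n m = some x) :
    K.levelProj a n m = x := by
  simp [levelProj, h]

theorem levelProj_zero_right (a : E) (n : ℕ) : K.levelProj a n 0 = (K.cover a)ᶜ :=
  levelProj_eq_of_levelSum (levelSum_zero_right a n)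

theorem levelProj_two_pow (hK : K.IsSpectral) (a : E) (n : ℕ) : K.levelProj a n (2 ^ n) = 1 :=
  levelProj_eq_of_levelSum (levelSum_two_pow hK a n)

theorem levelProj_oplus (hK : K.IsSpectral) (a : E) {n m : ℕ} (h : m < 2 ^ n) :
    oplus (K.levelProj a n m) (K.uProj a (binWord n m)) = some (K.levelProj a n (m + 1)) := by
  have h₁ := levelSum_eq_some hK a (Nat.succ_le_of_lt h)
  rwa [levelSum_succ_right, levelSum_eq_some hK a h.le] at h₁

theorem levelProj_mul_two_pow (hK : K.IsSpectral) (a : E) {n m : ℕ} (h : m ≤ 2 ^ n) (j : ℕ) :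
    K.levelProj a (n + j) (m * 2 ^ j) = K.levelProj a n m := by
  refine levelProj_eq_of_levelSum ?_
  induction j with
  | zero => simpa using levelSum_eq_some hK a h
  | succ j ih =>
    rw [show m * 2 ^ (j + 1) = 2 * (m * 2 ^ j) by ring]
    exact levelSum_two_mul hK a ih

theorem levelProj_mono (hK : K.IsSpectral) (a : E) {n m m' : ℕ} (hm : m ≤ m') (h : m' ≤ 2 ^ n) :
    K.levelProj a n m ≤ K.levelProj a n m' := by
  induction m', hm using Nat.le_induction with
  | base => exact le_rfl
  | succ k _ ih => exact (ih (by omega)).trans (le_of_oplus_left (levelProj_oplus hK a h))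

theorem levelProj_mem (hK : K.IsSpectral) (a : E) {n m : ℕ} (h : m ≤ 2 ^ n) :
    K.levelProj a n m ∈ K.P := by
  induction m with
  | zero =>
    rw [levelProj_zero_right]
    exact compl_mem (isProjectionCover_cover hK a).1
  | succ m ih =>
    exact K.isSubEffectAlgebra.oplus_mem _ (ih (by omega)) _ (uProj_mem hK a _) _
      (levelProj_oplus hK a h)

theorem binaryResolution_eq (hK : K.IsSpectral) (a : E) {n m : ℕ} (h : m ≤ 2 ^ n) {t : ℚ}
    (ht : t = (m : ℚ) / 2 ^ n) : K.binaryResolution a t = K.levelProj a n m := by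
  have hpow : (0 : ℚ) < 2 ^ n := by positivity
  rw [binaryResolution]
  split_ifs with h0 h1
  · obtain rfl : m = 0 := by
      rw [h0, eq_comm, div_eq_zero_iff] at ht
      exact_mod_cast ht.resolve_right hpow.ne'
    rw [levelProj_zero_right]
  · obtain rfl : m = 2 ^ n := by
      rw [h1, eq_comm, div_eq_one_iff_eq hpow.ne'] at ht
      exact_mod_cast ht
    rw [levelProj_two_pow hK]
  -- The definition uses lowest terms. The fraction `m / 2 ^ n` is obtained from these by a factor
  -- `2 ^ j`, which refinement absorbs.
  · have hden : t.den ∣ 2 ^ n := by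
      have h₁ := Rat.den_dvd m (2 ^ n : ℕ)
      rw [Rat.divInt_eq_div] at h₁
      push_cast at h₁
      rw [← ht] at h₁
      exact_mod_cast h₁
    obtain ⟨k, hk, hd⟩ := (Nat.dvd_prime_pow Nat.prime_two).1 hden
    obtain ⟨j, rfl⟩ := Nat.exists_eq_add_of_le hk
    rw [hd, Nat.log_pow one_lt_two]
    have hnum : t.num = (t.num.toNat : ℤ) := by
      have : 0 ≤ t.num := Rat.num_nonneg.2 (ht ▸ by positivity)
      omega
    have hm : m = t.num.toNat * 2 ^ j := by
      have h₁ := (Rat.num_div_den t).trans ht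
      rw [hd, hnum, pow_add, Int.cast_natCast, Nat.cast_pow, Nat.cast_ofNat,
        div_eq_div_iff (by positivity) (by positivity)] at h₁
      refine Nat.eq_of_mul_eq_mul_right (show 0 < 2 ^ k by positivity) ?_
      rw [mul_assoc, mul_comm (2 ^ j)]
      exact_mod_cast h₁.symm
    have hle : t.num.toNat ≤ 2 ^ k := by
      rw [hm, pow_add] at h
      exact Nat.le_of_mul_le_mul_right h (by positivity)
    conv_rhs => rw [hm, levelProj_mul_two_pow hK a hle]
    rfl

theorem exists_of_mem_dyadicUnit {t : ℚ} (ht : t ∈ dyadicUnit) :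
    ∃ n m : ℕ, m ≤ 2 ^ n ∧ t = (m : ℚ) / 2 ^ n := by
  obtain ⟨-, h1, m, n, rfl⟩ := ht
  rw [div_le_one (by positivity)] at h1
  exact ⟨n, m, by exact_mod_cast h1, rfl⟩

theorem div_mem_dyadicUnit {n m : ℕ} (h : m ≤ 2 ^ n) : (m : ℚ) / 2 ^ n ∈ dyadicUnit := by
  refine ⟨by positivity, ?_, m, n, rfl⟩
  rw [div_le_one (by positivity)]
  exact_mod_cast h

theorem binaryResolution_mono (hK : K.IsSpectral) (a : E) {s t : ℚ} (hs : s ∈ dyadicUnit)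
    (ht : t ∈ dyadicUnit) (hst : s ≤ t) : K.binaryResolution a s ≤ K.binaryResolution a t := by
  obtain ⟨n, m, hm, hs⟩ := exists_of_mem_dyadicUnit hs
  obtain ⟨n', m', hm', ht⟩ := exists_of_mem_dyadicUnit ht
  rw [binaryResolution_eq hK a hm hs, binaryResolution_eq hK a hm' ht,
    ← levelProj_mul_two_pow hK a hm n', ← levelProj_mul_two_pow hK a hm' n, add_comm n']
  refine levelProj_mono hK a ?_ ?_
  · rw [hs, ht, div_le_div_iff₀ (by positivity) (by positivity)] at hst
    exact_mod_cast hst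
  · rw [add_comm, pow_add]
    exact Nat.mul_le_mul_right _ hm'

/-! ### The two implications. -/

/-- In an archimedean spectral effect algebra, a projection below all
`p_{a,(m + 2 ^ (-j)) / 2 ^ n}` is below `p_{a, m / 2 ^ n}`. -/
theorem le_levelProj_of_forall_le (hK : K.IsSpectral) (hE : IsArchimedean E) (a : E) {n m : ℕ}
    (h : m < 2 ^ n) {q : E} (hq : q ∈ K.P)
    (hle : ∀ j, q ≤ K.levelProj a (n + j) (m * 2 ^ j + 1)) : q ≤ K.levelProj a n m := by
  have hw := isProjectionCover_cu hK a (binWord n m)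
  have hlt : ∀ j, m * 2 ^ j < 2 ^ (n + j) := fun j => by
    rw [pow_add]
    exact Nat.mul_lt_mul_of_pos_right h (by positivity)
  have hstep : ∀ j, oplus (K.levelProj a n m)
      (K.uProj a (binWord n m ++ List.replicate j false)) =
      some (K.levelProj a (n + j) (m * 2 ^ j + 1)) := fun j => by
    rw [← binWord_mul_two_pow, ← levelProj_mul_two_pow hK a h.le j]
    exact levelProj_oplus hK a (hlt j)
  have hp := levelProj_mem hK a h.le
  have hw' : (K.cu a (binWord n m)).1 ≤ (K.levelProj a n m)ᶜ :=
    hw.le.trans (le_compl_iff.2 ⟨_, oplus_comm _ _ _ (by simpa using hstep 0)⟩)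
  have hzero : K.J q (K.cu a (binWord n m)).1 = 0 := by
    refine hE _ fun i => ?_
    have hs := levelProj_mem hK a (Nat.succ_le_of_lt (hlt i))
    have hu := uProj_mem hK a (binWord n m ++ List.replicate i false)
    -- Since `c_w` lies below the complement of the lower value, compressing it to `u_{w0…0}` or to
    -- the whole upper value gives the same result. As `q` is below the upper value, a further `J_q`
    -- leaves just `J_q(c_w)`, so `2 ^ i` copies of it can be summed.
    have h₁ := J_oplus hp hu (hstep i) (mem_commutant_compl.1
      (mem_commutant_of_le (compl_mem hp) hw'))
    rw [(J_eq_zero_iff hp).2 hw', zero_oplus] at h₁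
    have h₂ := (J_additive hq).osum_replicate (osum_replicate_J_cu hK a (binWord n m) i)
    rw [Option.some.inj h₁, J_J_of_le hs hq (hle i)] at h₂
    exact osum_replicate_of_le Nat.lt_two_pow_self.le h₂
  have hu : K.uProj a (binWord n m) ≤ qᶜ :=
    (hw.2 _ (compl_mem hq)).1 ((J_eq_zero_iff hq).1 hzero)
  have h₀ := hstep 0
  rw [List.replicate_zero, List.append_nil] at h₀
  -- As `u_w ≤ q'`, compressing by `q` the sum that dominates it leaves only the lower value, whose
  -- compression is therefore all of `q`.
  have h₁ := J_additive hq _ _ _ h₀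
  rw [(J_eq_zero_iff hq).2 hu, oplus_zero] at h₁
  have h₂ := J_mono hq (hle 0)
  rw [J_of_le hq le_rfl, ← Option.some.inj h₁] at h₂
  have h₃ := J_oplus_J_compl hq (K.levelProj a n m)
  rw [le_antisymm (J_le hq _) h₂] at h₃
  have h₄ := (J_eq_zero_iff hq).1 (oplus_cancel h₃ (oplus_zero q))
  rwa [le_compl_comm', compl_compl'] at h₄

theorem isGLB_binaryResolution (hK : K.IsSpectral) (hE : IsArchimedean E) (a : E) {t : ℚ}
    (ht : t ∈ dyadicUnit) : IsGLB (K.binaryResolution a '' {s | s ∈ dyadicUnit ∧ t < s})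
      (K.binaryResolution a t) := by
  refine ⟨?_, fun x hx => ?_⟩
  · rintro _ ⟨s, ⟨hs, hts⟩, rfl⟩
    exact binaryResolution_mono hK a ht hs hts.le
  obtain ⟨n, m, hm, htm⟩ := exists_of_mem_dyadicUnit ht
  rw [binaryResolution_eq hK a hm htm]
  rcases hm.eq_or_lt with rfl | hlt
  · rw [levelProj_two_pow hK]
    exact le_one' x
  -- All values are projections, so the cover of `x` is a lower bound too. It suffices to test the
  -- points `(m * 2 ^ j + 1) / 2 ^ (n + j)`.
  have hcov := isProjectionCover_cover hK x
  refine hcov.le.trans (le_levelProj_of_forall_le hK hE a hlt hcov.1 fun j => ?_)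
  have hj : m * 2 ^ j + 1 ≤ 2 ^ (n + j) := by
    rw [pow_add]
    exact Nat.succ_le_of_lt (Nat.mul_lt_mul_of_pos_right hlt (by positivity))
  refine (hcov.2 _ (levelProj_mem hK a hj)).1 ?_
  rw [← binaryResolution_eq hK a hj rfl]
  refine hx ⟨_, ⟨div_mem_dyadicUnit hj, ?_⟩, rfl⟩
  rw [htm, div_lt_div_iff₀ (by positivity) (by positivity)]
  push_cast
  have : (0 : ℚ) < 2 ^ n := by positivity
  rw [pow_add]
  nlinarith

/-- Inductively `c_{0…0} = 2 ^ n a`. Since `2 ^ n a ⊕ 2 ^ n a` exists, this element is below its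
orthosupplement, so the next step splits nothing off. -/
theorem uProj_replicate_false (hK : K.IsSpectral) {a : E}
    (h : ∀ n : ℕ, ∃ c, osum (List.replicate n a) = some c) (n : ℕ) :
    K.uProj a (List.replicate n false) = K.cover a := by
  have ha := isProjectionCover_cover hK a
  induction n with
  | zero => rfl
  | succ n ih =>
    have hs := isSplitting_cu hK a (List.replicate n false)
    rw [← List.replicate_succ', ih] at hs
    refine hs.eq_of_le ?_
    have h₁ := osum_replicate_J_cu hK a [] n
    rw [List.nil_append, ih, show (K.cu a []).1 = a from rfl, J_of_le ha.1 ha.le] at h₁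
    obtain ⟨c, hc⟩ := h (2 ^ n + 2 ^ n)
    exact le_compl_iff.2 ⟨c, exists_oplus_of_osum_replicate_add h₁ h₁ hc⟩

theorem isArchimedean_of_isGLB (hK : K.IsSpectral)
    (h : ∀ a : E, IsGLB (K.binaryResolution a '' {s | s ∈ dyadicUnit ∧ 0 < s})
      (K.binaryResolution a 0)) : IsArchimedean E := by
  intro a ha
  have hcov := isProjectionCover_cover hK a
  have h₁ : (1 : E) ≤ K.binaryResolution a 0 := by
    refine (h a).2 ?_
    rintro _ ⟨s, ⟨hs, h0⟩, rfl⟩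
    obtain ⟨n, m, hm, hsm⟩ := exists_of_mem_dyadicUnit hs
    have hpos : 1 ≤ m := by
      rw [hsm] at h0
      rcases Nat.eq_zero_or_pos m with rfl | hpos
      · simp at h0
      · exact hpos
    rw [binaryResolution_eq hK a hm hsm]
    -- Already the first summand of level `n` is `u_{0…0} = a°`, which together with `(a°)'` makes
    -- `1`.
    refine le_trans (Eq.le ?_) (levelProj_mono hK a hpos hm)
    have h₂ := levelProj_oplus hK a (show 0 < 2 ^ n by positivity)
    have h₃ := binWord_mul_two_pow 0 0 n
    rw [zero_add, zero_mul] at h₃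
    rw [levelProj_zero_right, h₃, show binWord 0 0 = [] from rfl, List.nil_append,
      uProj_replicate_false hK ha, compl_oplus] at h₂
    exact Option.some.inj h₂
  rw [binaryResolution, if_pos rfl, le_compl_comm', compl_one] at h₁
  exact le_zero_iff'.1 (hcov.le.trans h₁)

end CompressionBase

theorem mainTheorem4 {E : Type u} [EffectAlgebra E] (K : CompressionBase E)
    (hK : K.IsSpectral) :
    (∀ a : E, ∀ t ∈ dyadicUnit,
      IsGLB (K.binaryResolution a '' {s | s ∈ dyadicUnit ∧ t < s}) (K.binaryResolution a t)) ↔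
    EffectAlgebra.IsArchimedean E :=
  ⟨fun h => CompressionBase.isArchimedean_of_isGLB hK fun a =>
    h a 0 ⟨le_rfl, zero_le_one, 0, 0, by simp⟩,
    fun hE a _ ht => CompressionBase.isGLB_binaryResolution hK hE a ht⟩
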